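/- Let $X_1,X_2,\dots$ be i.i.d. random variables with values in a measurable space $\mathcal X$, let $\Theta$ be a measurable space, let $f:\Theta\times\mathcal X\to[0,1]$ be a fixed (jointly) measurable function, and let $P_0$ be a fixed probability measure on $\Theta$ (the prior, not depending on the sample). For $n\ge 1$ put $$\mu_\theta:=\mathbb E[f(\theta,X_1)],\qquad \hat\mu_\theta:=\frac1n\sum_{i=1}^n f(\theta,X_i).$$ A data-dependent distribution $P_n$ on $\Theta$ is the value $P_n=K(X_1,\dots,X_n)$ at the sample of a probability kernel $K$ from $\mathcal X^n$ to $\Theta$; put $$\mathcal C_n:=\mathrm{KL}(P_n\,\|\,P_0)+\ln\frac{\sqrt\pi\,\Gamma(n+1)}{\Gamma(n+\frac12)},$$ where $\mathrm{KL}(P\|Q)=\int\ln\frac{dP}{dQ}\,dP$ if $P\ll Q$, and $\mathrm{KL}(P\|Q)=+\infty$ otherwise. Let $\delta\in(0,1]$. Then, with probability at least $1-\delta$ over the sample, simultaneously for all integers $n\ge 1$ and all data-dependent distributions $P_n$, $$\left|\int\mu_\theta\,dP_n(\theta)-\int\hat\mu_\theta\,dP_n(\theta)\right|\le 2\sqrt{\frac{\mathcal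 C_n+\ln\frac1\delta}{n}},$$ where the right-hand side is $+\infty$ if $\mathrm{KL}(P_n\|P_0)=+\infty$. (That the bound holds with probability at least $1-\delta$ means that it holds on a measurable event of probability at least $1-\delta$.) -/

import Mathlib

open MeasureTheory ProbabilityTheory

namespace PACBayes

/-- The mean `μ_θ = E[f(θ, X₁)]`, where `Z` is the first sample point. -/
noncomputable def mean {Ω 𝒳 Θ : Type*} [MeasurableSpace Ω] (Pr : Measure Ω)
    (f : Θ → 𝒳 → ℝ) (Z : Ω → 𝒳) (θ : Θ) : ℝ :=
  ∫ ω, f θ (Z ω) ∂Pr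

/-- The empirical mean `(1/n) ∑ f(θ, x_i)` of the sample `s = (x_1, …, x_n)`. -/
noncomputable def empMean {𝒳 Θ : Type*} (f : Θ → 𝒳 → ℝ) {n : ℕ} (s : Fin n → 𝒳) (θ : Θ) : ℝ :=
  (1 / (n : ℝ)) * ∑ i : Fin n, f θ (s i)

/-- The complexity term `KL(P ‖ P₀) + ln (√π Γ(n+1) / Γ(n+1/2))`,
used for `KL(P ‖ P₀) < ∞` only. -/
noncomputable def complexity {Θ : Type*} [MeasurableSpace Θ] (n : ℕ) (P P₀ : Measure Θ) : ℝ :=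
  (InformationTheory.klDiv P P₀).toReal +
    Real.log (Real.sqrt Real.pi * Real.Gamma ((n : ℝ) + 1) / Real.Gamma ((n : ℝ) + 1 / 2))

end PACBayes

/-! For fixed `θ` and stake `t`, Hoeffding's lemma makes the product over `i` of `exp (t (f(θ, X_i)
- μ_θ) - t²/8)` a nonnegative supermartingale. Averaging over `θ ∼ P₀` and `t ∼ N(0,1)` preserves
this and the initial value 1, so by Ville's inequality the average stays below `1/δ` at all times
with probability at least `1 - δ`.

On that event nothing random remains. With `D = μ_θ - μ̂_θ`, the integral over `t` is explicit and
dominates `exp (n D²/4) / √(n+1)`. Donsker–Varadhan moves `n D²/4` from `P₀` to any posterior at the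
cost of the KL term, Jensen passes to `(∫ D)²`, and `√(n+1)` is at most the Gamma ratio. -/

namespace PACBayes

open scoped ENNReal

/-! ### Maximal inequality for mixtures of supermartingales -/

/-- **Ville's inequality** for nonnegative supermartingales with values in `ℝ≥0∞`. -/
lemma mul_measure_exists_le_le_lintegral {Ω : Type*} {mΩ : MeasurableSpace Ω} (μ : Measure Ω)
    (ℱ : Filtration ℕ mΩ) (M : ℕ → Ω → ℝ≥0∞) (hM : ∀ n, Measurable[ℱ n] (M n))
    (hstep : ∀ n B, MeasurableSet[ℱ n] B →
      ∫⁻ ω in B, M (n + 1) ω ∂μ ≤ ∫⁻ ω in B, M n ω ∂μ) (c : ℝ≥0∞) :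
    c * μ {ω | ∃ n, c ≤ M n ω} ≤ ∫⁻ ω, M 0 ω ∂μ := by
  have hMm : ∀ n, Measurable (M n) := fun n => (hM n).mono (ℱ.le n) le_rfl
  set D : ℕ → Set Ω := fun N => {ω | ∃ k ≤ N, c ≤ M k ω} with hD
  have hDF : ∀ N, MeasurableSet[ℱ N] (D N) := by
    intro N
    have : D N = ⋃ k ∈ Set.Iic N, M k ⁻¹' Set.Ici c := by ext; simp [hD]
    rw [this]
    refine MeasurableSet.biUnion (Set.to_countable _) fun k hk => ?_
    exact ℱ.mono hk _ (hM k measurableSet_Ici)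
  have hsplit : ∀ (N : ℕ) (E : Set Ω),
      c * μ (E ∩ {ω | c ≤ M N ω}) + ∫⁻ ω in E \ {ω | c ≤ M N ω}, M N ω ∂μ
        ≤ ∫⁻ ω in E, M N ω ∂μ := by
    intro N E
    have hs : MeasurableSet {ω | c ≤ M N ω} := hMm N measurableSet_Ici
    rw [← lintegral_inter_add_sdiff (M N) E hs]
    gcongr
    rw [← setLIntegral_const, ← Measure.restrict_restrict_of_subset Set.inter_subset_right]
    refine lintegral_mono_ae ?_
    rw [Measure.restrict_restrict_of_subset Set.inter_subset_right, Set.inter_comm,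
      ← Measure.restrict_restrict hs]
    exact ae_restrict_of_forall_mem hs fun ω hω => hω
  -- The left side bounds from below the mean of `M` stopped at its first passage above `c`: at
  -- least `c` where passage has occurred, `M N` elsewhere.
  have key : ∀ N, c * μ (D N) + ∫⁻ ω in (D N)ᶜ, M N ω ∂μ ≤ ∫⁻ ω, M 0 ω ∂μ := by
    intro N
    induction N with
    | zero =>
      have h := hsplit 0 Set.univ
      have h0 : D 0 = {ω | c ≤ M 0 ω} := by ext; simp [hD]
      rwa [Set.univ_inter, Measure.restrict_univ, ← Set.compl_eq_univ_sdiff, ← h0] at h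
    | succ N ih =>
      have h1 : D (N + 1) = D N ∪ (D N)ᶜ ∩ {ω | c ≤ M (N + 1) ω} := by
        rw [Set.union_inter_distrib_left, Set.union_compl_self, Set.univ_inter]
        ext ω
        simp only [hD, Set.mem_ofPred_eq, Set.mem_union]
        constructor
        · rintro ⟨k, hk, h⟩
          rcases Nat.le_succ_iff.1 hk with hk | rfl
          · exact Or.inl ⟨k, hk, h⟩
          · exact Or.inr h
        · rintro (⟨k, hk, h⟩ | h)
          · exact ⟨k, hk.trans (Nat.le_succ N), h⟩
          · exact ⟨N + 1, le_rfl, h⟩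
      have h2 : (D (N + 1))ᶜ = (D N)ᶜ \ {ω | c ≤ M (N + 1) ω} := by
        rw [h1]; ext ω; simp; tauto
      calc c * μ (D (N + 1)) + ∫⁻ ω in (D (N + 1))ᶜ, M (N + 1) ω ∂μ
          ≤ c * (μ (D N) + μ ((D N)ᶜ ∩ {ω | c ≤ M (N + 1) ω}))
              + ∫⁻ ω in (D N)ᶜ \ {ω | c ≤ M (N + 1) ω}, M (N + 1) ω ∂μ := by
            rw [h2, h1]; gcongr; exact measure_union_le _ _
        _ = c * μ (D N) + (c * μ ((D N)ᶜ ∩ {ω | c ≤ M (N + 1) ω})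
              + ∫⁻ ω in (D N)ᶜ \ {ω | c ≤ M (N + 1) ω}, M (N + 1) ω ∂μ) := by
            rw [mul_add, add_assoc]
        _ ≤ c * μ (D N) + ∫⁻ ω in (D N)ᶜ, M N ω ∂μ := by
            gcongr
            exact (hsplit (N + 1) _).trans (hstep N _ (hDF N).compl)
        _ ≤ _ := ih
  have hU : {ω | ∃ n, c ≤ M n ω} = ⋃ N, D N := by
    ext ω
    simp only [hD, Set.mem_ofPred_eq, Set.mem_iUnion]
    exact ⟨fun ⟨n, h⟩ => ⟨n, n, le_rfl, h⟩, fun ⟨_, k, _, h⟩ => ⟨k, h⟩⟩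
  have hmono : Monotone D := fun a b hab ω ⟨k, hk, h⟩ => ⟨k, hk.trans hab, h⟩
  rw [hU, hmono.measure_iUnion, ENNReal.mul_iSup]
  exact iSup_le fun N => le_self_add.trans (key N)

/-- The wealth, averaged over the mixing measure `Q`, of a gambler who bets at fair (or
disadvantageous) odds on independent outcomes reaches `c` with probability at most `1 / c`. -/
lemma mul_measure_exists_le_mixture_le_one {Ω 𝒳 Λ : Type*} {mΩ : MeasurableSpace Ω}
    [MeasurableSpace 𝒳] [MeasurableSpace Λ] (μ : Measure Ω) [IsProbabilityMeasure μ]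
    (Q : Measure Λ) [IsProbabilityMeasure Q] (X : ℕ → Ω → 𝒳) (hX : ∀ i, Measurable (X i))
    (hindep : iIndepFun X μ) (h : Λ → 𝒳 → ℝ≥0∞) (hh : Measurable (Function.uncurry h))
    (hle : ∀ l i, ∫⁻ ω, h l (X i ω) ∂μ ≤ 1) (c : ℝ≥0∞) :
    c * μ {ω | ∃ n, c ≤ ∫⁻ l, ∏ i ∈ Finset.range n, h l (X i ω) ∂Q} ≤ 1 := by
  -- Strict past: `ℱ n` is generated by `X i` with `i < n`, so the next outcome `X n` is independent
  -- of it.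
  let ℱ : Filtration ℕ mΩ :=
    { seq := fun n => ⨆ i ∈ Set.Iio n, MeasurableSpace.comap (X i) inferInstance
      mono' := fun a b hab => biSup_mono fun i hi => lt_of_lt_of_le hi hab
      le' := fun n => iSup₂_le fun i _ => (hX i).comap_le }
  have hXF : ∀ n, ∀ i < n, Measurable[ℱ n] (X i) := fun n i hi =>
    measurable_iff_comap_le.2
      (le_iSup₂_of_le (f := fun i (_ : i ∈ Set.Iio n) => MeasurableSpace.comap (X i) _) i hi le_rfl)
  have hprod : ∀ {m : MeasurableSpace Ω} (n : ℕ), (∀ i < n, Measurable[m] (X i)) →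
      Measurable[m.prod inferInstance]
        (fun p : Ω × Λ => ∏ i ∈ Finset.range n, h p.2 (X i p.1)) := by
    intro m n hm
    refine Finset.measurable_fun_prod _ fun i hi => ?_
    exact hh.comp (measurable_snd.prodMk ((hm i (Finset.mem_range.1 hi)).comp measurable_fst))
  have hM : ∀ n, Measurable[ℱ n] fun ω => ∫⁻ l, ∏ i ∈ Finset.range n, h l (X i ω) ∂Q := fun n =>
    @Measurable.lintegral_prod_right' Ω Λ (ℱ n) _ Q _ _ (hprod n (hXF n))
  refine (mul_measure_exists_le_le_lintegral μ ℱ _ hM ?_ c).trans (by simp)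
  intro n B hB
  have hBm : MeasurableSet B := ℱ.le n _ hB
  -- By Tonelli, the supermartingale inequality need only be checked for each `l` separately.
  have hswap : ∀ k, ∫⁻ ω in B, ∫⁻ l, ∏ i ∈ Finset.range k, h l (X i ω) ∂Q ∂μ =
      ∫⁻ l, ∫⁻ ω in B, ∏ i ∈ Finset.range k, h l (X i ω) ∂μ ∂Q := fun k =>
    lintegral_lintegral_swap (f := fun ω l => ∏ i ∈ Finset.range k, h l (X i ω))
      (hprod k fun i _ => hX i).aemeasurable
  rw [hswap, hswap]
  refine lintegral_mono fun l => ?_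
  have hind : Indep (ℱ n) (MeasurableSpace.comap (X n) inferInstance) μ := by
    have := indep_iSup_of_disjoint (fun i => (hX i).comap_le) hindep.iIndep
      (S := Set.Iio n) (T := {n}) (by simp)
    rwa [iSup_singleton] at this
  have hf : Measurable[ℱ n] (B.indicator fun ω => ∏ i ∈ Finset.range n, h l (X i ω)) := by
    refine Measurable.indicator ?_ hB
    exact (hprod n (hXF n)).comp (@measurable_prodMk_right Ω Λ (ℱ n) _ l)
  have hg : Measurable[MeasurableSpace.comap (X n) inferInstance] fun ω => h l (X n ω) :=
    (hh.comp measurable_prodMk_left).comp (comap_measurable (X n))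
  calc ∫⁻ ω in B, ∏ i ∈ Finset.range (n + 1), h l (X i ω) ∂μ
      = ∫⁻ ω, B.indicator (fun ω => ∏ i ∈ Finset.range n, h l (X i ω)) ω * h l (X n ω) ∂μ := by
        rw [← lintegral_indicator hBm]
        refine lintegral_congr fun ω => ?_
        by_cases hω : ω ∈ B <;> simp [hω, Finset.prod_range_succ]
    _ = (∫⁻ ω in B, ∏ i ∈ Finset.range n, h l (X i ω) ∂μ) * ∫⁻ ω, h l (X n ω) ∂μ := by
        rw [lintegral_mul_eq_lintegral_mul_lintegral_of_independent_measurableSpace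
          (ℱ.le n) (hX n).comap_le hind hf hg, lintegral_indicator hBm]
    _ ≤ ∫⁻ ω in B, ∏ i ∈ Finset.range n, h l (X i ω) ∂μ := mul_le_of_le_one_right' (hle l n)

/-! ### Change of measure and scalar estimates -/

/-- The easy half of the **Donsker–Varadhan variational formula**. -/
lemma integral_le_toReal_klDiv_add_log {Θ : Type*} [MeasurableSpace Θ] (P P₀ : Measure Θ)
    [IsProbabilityMeasure P] [IsProbabilityMeasure P₀]
    (hkl : InformationTheory.klDiv P P₀ ≠ ⊤) (g : Θ → ℝ) (hgP : Integrable g P)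
    (hg : Integrable (fun θ => Real.exp (g θ)) P₀) :
    ∫ θ, g θ ∂P ≤
      (InformationTheory.klDiv P P₀).toReal + Real.log (∫ θ, Real.exp (g θ) ∂P₀) := by
  obtain ⟨hac, hint⟩ := InformationTheory.klDiv_ne_top_iff.1 hkl
  have : IsProbabilityMeasure (P₀.tilted g) := isProbabilityMeasure_tilted hg
  -- Gibbs' inequality: the divergence of `P` from `P₀` tilted by `g` is nonnegative, and its
  -- expansion is the claim.
  have h := InformationTheory.integral_llr_add_sub_measure_univ_nonneg
    (hac.trans (absolutelyContinuous_tilted hg)) (integrable_llr_tilted_right hac hgP hint hg)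
  rw [integral_llr_tilted_right hac hgP hg hint] at h
  rw [InformationTheory.toReal_klDiv_of_measure_eq hac (by simp)]
  simp only [probReal_univ] at h
  linarith

/-- Completing the square: the Gaussian weight raises `b` to `b + 1/2`, and the centre becomes `a /
(2b + 1)`. -/
lemma lintegral_exp_quadratic_gaussianReal (a b : ℝ) (hb : 0 ≤ b) :
    ∫⁻ t, ENNReal.ofReal (Real.exp (a * t - b * t ^ 2)) ∂(gaussianReal 0 1) =
      ENNReal.ofReal (Real.exp (a ^ 2 / (4 * b + 2)) / Real.sqrt (2 * b + 1)) := by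
  have hb' : 0 < b + 1 / 2 := by positivity
  have hint : Integrable fun t : ℝ =>
      Real.exp (-(b + 1 / 2) * (t - a / (2 * b + 1)) ^ 2) :=
    (integrable_exp_neg_mul_sq hb').comp_sub_right _
  rw [gaussianReal_of_var_ne_zero _ one_ne_zero,
    lintegral_withDensity_eq_lintegral_mul _ (measurable_gaussianPDF 0 1) (by fun_prop)]
  have hcongr : ∀ t : ℝ, (gaussianPDF 0 1 * fun t =>
        ENNReal.ofReal (Real.exp (a * t - b * t ^ 2))) t =
      ENNReal.ofReal ((Real.sqrt (2 * Real.pi))⁻¹ * Real.exp (a ^ 2 / (4 * b + 2)) *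
        Real.exp (-(b + 1 / 2) * (t - a / (2 * b + 1)) ^ 2)) := by
    intro t
    rw [Pi.mul_apply, gaussianPDF, ← ENNReal.ofReal_mul (gaussianPDFReal_nonneg _ _ _),
      gaussianPDFReal]
    simp only [NNReal.coe_one, mul_one, mul_assoc, ← Real.exp_add]
    refine congrArg ENNReal.ofReal (congrArg _ (congrArg Real.exp ?_))
    have : 2 * b + 1 ≠ 0 := by positivity
    rw [show 4 * b + 2 = 2 * (2 * b + 1) by ring]
    field_simp
    ring
  rw [lintegral_congr hcongr, ← ofReal_integral_eq_lintegral_ofReal (hint.const_mul _)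
    (ae_of_all _ fun t => by positivity), integral_const_mul,
    integral_sub_right_eq_self (fun t : ℝ => Real.exp (-(b + 1 / 2) * t ^ 2)), integral_gaussian]
  congr 1
  have h1 : Real.pi / (b + 1 / 2) = 2 * Real.pi / (2 * b + 1) := by field_simp
  rw [h1, Real.sqrt_div (by positivity)]
  have : Real.sqrt (2 * Real.pi) ≠ 0 := by positivity
  field_simp

/-- Equality holds at `n = 0`. Each step multiplies the right side by `(n+1)/(n+1/2)`, which
outgrows the left because `(n+2)(n+1/2)² ≤ (n+1)³`. -/
lemma sqrt_le_sqrt_pi_mul_Gamma_div_Gamma (n : ℕ) :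
    Real.sqrt (n + 1) ≤
      Real.sqrt Real.pi * Real.Gamma ((n : ℝ) + 1) / Real.Gamma ((n : ℝ) + 1 / 2) := by
  induction n with
  | zero =>
    have : Real.sqrt Real.pi ≠ 0 := by positivity
    have h2 := Real.Gamma_one_half_eq
    norm_num at h2 ⊢
    rw [h2, div_self this]
  | succ n ih =>
    have hG : 0 < Real.Gamma ((n : ℝ) + 1 / 2) := Real.Gamma_pos_of_pos (by positivity)
    have h1 : Real.Gamma (((n + 1 : ℕ) : ℝ) + 1) = (n + 1) * Real.Gamma ((n : ℝ) + 1) := by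
      push_cast; exact Real.Gamma_add_one (by positivity)
    have h2 : Real.Gamma (((n + 1 : ℕ) : ℝ) + 1 / 2) =
        (n + 1 / 2) * Real.Gamma ((n : ℝ) + 1 / 2) := by
      rw [← Real.Gamma_add_one (by positivity)]; push_cast; congr 1; ring
    have h3 : Real.sqrt Real.pi * ((n + 1) * Real.Gamma ((n : ℝ) + 1)) /
        ((n + 1 / 2) * Real.Gamma ((n : ℝ) + 1 / 2)) = (n + 1) / (n + 1 / 2) *
          (Real.sqrt Real.pi * Real.Gamma ((n : ℝ) + 1) / Real.Gamma ((n : ℝ) + 1 / 2)) := by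
      field_simp
    rw [h1, h2, h3]
    refine le_trans ?_ (mul_le_mul_of_nonneg_left ih (by positivity))
    refine Real.sqrt_le_iff.2 ⟨by positivity, ?_⟩
    rw [mul_pow, Real.sq_sqrt (by positivity), div_pow, div_mul_eq_mul_div,
      le_div_iff₀ (by positivity)]
    push_cast
    nlinarith [sq_nonneg (n : ℝ), (Nat.cast_nonneg n : (0 : ℝ) ≤ n)]

/-- Hoeffding's lemma: a variable in `[0,1]` is sub-Gaussian with variance proxy `1/4`, whence the
exponent `t²/8`. -/
lemma lintegral_exp_centered_le_one {Ω : Type*} [MeasurableSpace Ω] (μ : Measure Ω)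
    [IsProbabilityMeasure μ] (Y : Ω → ℝ) (hY : Measurable Y) (hY01 : ∀ ω, Y ω ∈ Set.Icc (0 : ℝ) 1)
    (t : ℝ) :
    ∫⁻ ω, ENNReal.ofReal (Real.exp (t * (Y ω - ∫ ω, Y ω ∂μ) - t ^ 2 / 8)) ∂μ ≤ 1 := by
  have h := hasSubgaussianMGF_of_mem_Icc (μ := μ) hY.aemeasurable (ae_of_all _ hY01)
  have hi := (h.integrable_exp_mul t).div_const (Real.exp (t ^ 2 / 8))
  simp only [Real.exp_sub]
  rw [← ofReal_integral_eq_lintegral_ofReal hi (ae_of_all _ fun ω => by positivity),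
    integral_div, ENNReal.ofReal_le_one, div_le_one (Real.exp_pos _)]
  refine (h.mgf_le t).trans (Real.exp_le_exp.2 (le_of_eq ?_))
  norm_num
  ring

end PACBayes

namespace PACBayes

/-! ### From the prior mixture to every posterior -/

lemma measurable_mean {Ω 𝒳 Θ : Type*} [MeasurableSpace Ω] [MeasurableSpace 𝒳] [MeasurableSpace Θ]
    (Pr : Measure Ω) [SFinite Pr] (f : Θ → 𝒳 → ℝ) (hf : Measurable (Function.uncurry f))
    (Z : Ω → 𝒳) (hZ : Measurable Z) : Measurable (mean Pr f Z) :=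
  (StronglyMeasurable.integral_prod_right' (f := fun p : Θ × Ω => f p.1 (Z p.2))
    (hf.comp (measurable_fst.prodMk (hZ.comp measurable_snd))).stronglyMeasurable).measurable

lemma measurable_empMean {𝒳 Θ : Type*} [MeasurableSpace 𝒳] [MeasurableSpace Θ]
    (f : Θ → 𝒳 → ℝ) (hf : Measurable (Function.uncurry f)) {n : ℕ} (s : Fin n → 𝒳) :
    Measurable (empMean f s) :=
  (Finset.measurable_fun_sum _ fun i _ =>
    hf.comp (measurable_id.prodMk (measurable_const (a := s i)))).const_mul _

lemma mean_mem_Icc {Ω 𝒳 Θ : Type*} [MeasurableSpace Ω] (Pr : Measure Ω) [IsProbabilityMeasure Pr]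
    (f : Θ → 𝒳 → ℝ) (hf01 : ∀ θ x, f θ x ∈ Set.Icc (0 : ℝ) 1) (Z : Ω → 𝒳) (θ : Θ) :
    mean Pr f Z θ ∈ Set.Icc (0 : ℝ) 1 := by
  refine ⟨integral_nonneg fun ω => (hf01 _ _).1, ?_⟩
  refine (integral_mono_of_nonneg (ae_of_all _ fun ω => (hf01 _ _).1) (integrable_const 1)
    (ae_of_all _ fun ω => (hf01 _ _).2)).trans (by simp)

lemma empMean_mem_Icc {𝒳 Θ : Type*} (f : Θ → 𝒳 → ℝ) (hf01 : ∀ θ x, f θ x ∈ Set.Icc (0 : ℝ) 1)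
    {n : ℕ} (s : Fin n → 𝒳) (θ : Θ) : empMean f s θ ∈ Set.Icc (0 : ℝ) 1 := by
  rw [empMean, one_div, inv_mul_eq_div]
  refine ⟨div_nonneg (Finset.sum_nonneg fun i _ => (hf01 _ _).1) n.cast_nonneg,
    div_le_one_of_le₀ ?_ n.cast_nonneg⟩
  simpa using Finset.sum_le_sum fun i (_ : i ∈ Finset.univ) => (hf01 θ (s i)).2

/-- A bound on the Gaussian mixture wealth at the prior gives a bound on the mean deviation under
every posterior. -/
lemma abs_integral_le_of_lintegral_exp_le {Θ : Type*} [MeasurableSpace Θ] (P P₀ : Measure Θ)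
    [IsProbabilityMeasure P] [IsProbabilityMeasure P₀]
    (hkl : InformationTheory.klDiv P P₀ ≠ ⊤) (D : Θ → ℝ) (hD : Measurable D)
    (hD1 : ∀ θ, |D θ| ≤ 1) (n : ℕ) (hn : 1 ≤ n) (c : ℝ) (hc : 0 < c)
    (hM : ∫⁻ θ, ENNReal.ofReal (Real.exp ((n * D θ) ^ 2 / (4 * (n / 8 : ℝ) + 2)) /
      Real.sqrt (2 * (n / 8 : ℝ) + 1)) ∂P₀ ≤ ENNReal.ofReal c) :
    |∫ θ, D θ ∂P| ≤ 2 * Real.sqrt ((complexity n P P₀ + Real.log c) / n) := by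
  have hn0 : (1 : ℝ) ≤ n := by exact_mod_cast hn
  have hsq : ∀ θ, D θ ^ 2 ≤ 1 := fun θ => (sq_le_one_iff_abs_le_one _).2 (hD1 θ)
  have hDP : MemLp D 2 P := MemLp.of_bound hD.aestronglyMeasurable 1 (ae_of_all _ hD1)
  set g : Θ → ℝ := fun θ => n / 4 * D θ ^ 2 with hg
  have hgm : Measurable g := (hD.pow_const 2).const_mul _
  have hgi : Integrable g P := hDP.integrable_sq.const_mul _
  have hei : Integrable (fun θ => Real.exp (g θ)) P₀ := by
    refine Integrable.of_bound (Real.measurable_exp.comp hgm).aestronglyMeasurable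
      (Real.exp (n / 4)) (ae_of_all _ fun θ => ?_)
    rw [Real.norm_of_nonneg (Real.exp_pos _).le, Real.exp_le_exp]
    exact mul_le_of_le_one_right (by positivity) (hsq θ)
  have hexp : ∫ θ, Real.exp (g θ) ∂P₀ ≤ c * Real.sqrt (n + 1) := by
    rw [← div_le_iff₀ (by positivity), ← integral_div, ← ENNReal.ofReal_le_ofReal_iff hc.le,
      ofReal_integral_eq_lintegral_ofReal (hei.div_const _) (ae_of_all _ fun θ => by positivity)]
    refine (lintegral_mono fun θ => ENNReal.ofReal_le_ofReal ?_).trans hM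
    refine div_le_div₀ (Real.exp_pos _).le (Real.exp_le_exp.2 ?_) (by positivity)
      (Real.sqrt_le_sqrt (by linarith))
    -- The claim is `(n/4) D² (n/2 + 2) ≤ n² D²`, which follows from `n D² ≤ n² D²`; here `n ≥ 1` is
    -- needed.
    rw [le_div_iff₀ (by positivity)]
    have : 0 ≤ n * D θ ^ 2 * (n - 1 : ℝ) :=
      mul_nonneg (by positivity) (by linarith)
    have : 0 ≤ (n : ℝ) * n * D θ ^ 2 := by positivity
    simp only [hg]
    nlinarith
  have hpos : 0 < ∫ θ, Real.exp (g θ) ∂P₀ := integral_exp_pos hei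
  have hlog : Real.log (∫ θ, Real.exp (g θ) ∂P₀) ≤ Real.log c + Real.log
      (Real.sqrt Real.pi * Real.Gamma ((n : ℝ) + 1) / Real.Gamma ((n : ℝ) + 1 / 2)) := by
    have hs : 0 < Real.sqrt ((n : ℝ) + 1) := by positivity
    have hle := sqrt_le_sqrt_pi_mul_Gamma_div_Gamma n
    rw [← Real.log_mul hc.ne' (hs.trans_le hle).ne']
    exact Real.log_le_log hpos (hexp.trans (mul_le_mul_of_nonneg_left hle hc.le))
  have hDV := integral_le_toReal_klDiv_add_log P P₀ hkl g hgi hei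
  -- Jensen's inequality, as nonnegativity of the variance.
  have hJ : (∫ θ, D θ ∂P) ^ 2 ≤ ∫ θ, D θ ^ 2 ∂P := by
    have := variance_nonneg D P
    rw [variance_eq_sub hDP] at this
    simpa using this
  have hI : ∫ θ, g θ ∂P = n / 4 * ∫ θ, D θ ^ 2 ∂P := integral_const_mul _ _
  have hfin : (n : ℝ) / 4 * (∫ θ, D θ ∂P) ^ 2 ≤ complexity n P P₀ + Real.log c := by
    have := mul_le_mul_of_nonneg_left hJ (by positivity : (0 : ℝ) ≤ n / 4)
    rw [complexity]
    linarith
  have h2 : |∫ θ, D θ ∂P| / 2 ≤ Real.sqrt ((complexity n P P₀ + Real.log c) / n) := by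
    refine Real.le_sqrt_of_sq_le ?_
    rw [le_div_iff₀ (by positivity), div_pow, sq_abs]
    linarith
  linarith

end PACBayes

/-! ### The time-uniform bound -/

theorem proposition1 {Ω 𝒳 Θ : Type*} [MeasurableSpace Ω] [MeasurableSpace 𝒳] [MeasurableSpace Θ]
    (Pr : Measure Ω) [IsProbabilityMeasure Pr]
    (X : ℕ → Ω → 𝒳) (hX : ∀ i, Measurable (X i))
    (hindep : iIndepFun X Pr) (hident : ∀ i, IdentDistrib (X i) (X 0) Pr Pr)
    (f : Θ → 𝒳 → ℝ) (hf : Measurable (Function.uncurry f))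
    (hf01 : ∀ θ x, f θ x ∈ Set.Icc (0 : ℝ) 1)
    (P₀ : Measure Θ) [IsProbabilityMeasure P₀]
    (δ : ℝ) (hδ : δ ∈ Set.Ioc (0 : ℝ) 1) :
    ∃ A : Set Ω, MeasurableSet A ∧ ENNReal.ofReal (1 - δ) ≤ Pr A ∧
      ∀ ω ∈ A, ∀ n : ℕ, 1 ≤ n → ∀ P : Kernel (Fin n → 𝒳) Θ, IsMarkovKernel P →
        InformationTheory.klDiv (P fun i : Fin n => X i ω) P₀ ≠ ⊤ →
        |(∫ θ, PACBayes.mean Pr f (X 0) θ ∂(P fun i : Fin n => X i ω)) -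
            ∫ θ, PACBayes.empMean f (fun i : Fin n => X i ω) θ ∂(P fun i : Fin n => X i ω)| ≤
          2 * Real.sqrt
            ((PACBayes.complexity n (P fun i : Fin n => X i ω) P₀ + Real.log (1 / δ)) / n) := by
  obtain ⟨hδ0, hδ1⟩ := hδ
  have hμ := PACBayes.measurable_mean Pr f hf (X 0) (hX 0)
  have hfθ : ∀ θ, Measurable (f θ) := fun θ => hf.comp measurable_prodMk_left
  set h : Θ × ℝ → 𝒳 → ENNReal := fun l x => ENNReal.ofReal
    (Real.exp (l.2 * (f l.1 x - PACBayes.mean Pr f (X 0) l.1) - l.2 ^ 2 / 8)) with hdef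
  have hh : Measurable (Function.uncurry h) := by
    have h1 : Measurable fun p : (Θ × ℝ) × 𝒳 => f p.1.1 p.2 :=
      hf.comp ((measurable_fst.comp measurable_fst).prodMk measurable_snd)
    have h2 : Measurable fun p : (Θ × ℝ) × 𝒳 => PACBayes.mean Pr f (X 0) p.1.1 :=
      hμ.comp (measurable_fst.comp measurable_fst)
    have h3 : Measurable fun p : (Θ × ℝ) × 𝒳 => p.1.2 := by fun_prop
    exact ENNReal.measurable_ofReal.comp (Real.measurable_exp.comp
      ((h3.mul (h1.sub h2)).sub ((h3.pow_const 2).div_const 8)))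
  have hle : ∀ l i, ∫⁻ ω, h l (X i ω) ∂Pr ≤ 1 := by
    intro l i
    have hmean : PACBayes.mean Pr f (X 0) l.1 = ∫ ω, f l.1 (X i ω) ∂Pr :=
      ((hident i).comp (hfθ l.1)).integral_eq.symm
    simp only [hdef, hmean]
    exact PACBayes.lintegral_exp_centered_le_one Pr (fun ω => f l.1 (X i ω))
      ((hfθ l.1).comp (hX i)) (fun ω => hf01 _ _) l.2
  set W : ℕ → Ω → ENNReal := fun n ω =>
    ∫⁻ l, ∏ i ∈ Finset.range n, h l (X i ω) ∂(P₀.prod (gaussianReal 0 1)) with hW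
  have hprod : ∀ n, Measurable fun p : Ω × (Θ × ℝ) =>
      ∏ i ∈ Finset.range n, h p.2 (X i p.1) := fun n =>
    Finset.measurable_fun_prod _ fun i _ =>
      hh.comp (measurable_snd.prodMk ((hX i).comp measurable_fst))
  have hWm : ∀ n, Measurable (W n) := fun n => (hprod n).lintegral_prod_right'
  have hville : ENNReal.ofReal (1 / δ) * Pr {ω | ∃ n, ENNReal.ofReal (1 / δ) ≤ W n ω} ≤ 1 :=
    PACBayes.mul_measure_exists_le_mixture_le_one Pr (P₀.prod (gaussianReal 0 1)) X hX hindep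
      h hh hle (ENNReal.ofReal (1 / δ))
  have hBm : MeasurableSet {ω | ∃ n, ENNReal.ofReal (1 / δ) ≤ W n ω} := by
    have : {ω | ∃ n, ENNReal.ofReal (1 / δ) ≤ W n ω} =
        ⋃ n, W n ⁻¹' Set.Ici (ENNReal.ofReal (1 / δ)) := by ext; simp
    rw [this]
    exact MeasurableSet.iUnion fun n => hWm n measurableSet_Ici
  -- The good event is that the wealth never reaches `1/δ`. For `δ = 1` it is empty, since `W 0 =
  -- 1`; this is harmless as the required probability is then 0.
  refine ⟨{ω | ∃ n, ENNReal.ofReal (1 / δ) ≤ W n ω}ᶜ, hBm.compl, ?_, ?_⟩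
  · rw [prob_compl_eq_one_sub hBm, ENNReal.ofReal_sub _ hδ0.le, ENNReal.ofReal_one]
    refine tsub_le_tsub_left ?_ _
    generalize {ω | ∃ n, ENNReal.ofReal (1 / δ) ≤ W n ω} = B at hville ⊢
    rw [one_div, ENNReal.ofReal_inv_of_pos hδ0, ENNReal.inv_mul_le_iff
      (by simpa using hδ0) ENNReal.ofReal_ne_top, mul_one] at hville
    exact hville
  -- The event does not involve `P`, and the kernel enters only through its value at the sample, so
  -- uniformity over posteriors is automatic.
  · intro ω hω n hn P hP hkl
    have hlt : W n ω ≤ ENNReal.ofReal (1 / δ) :=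
      (not_le.1 fun hge => hω ⟨n, hge⟩).le
    set s : Fin n → 𝒳 := fun i => X i ω with hs
    have he := PACBayes.measurable_empMean f hf s
    have hn0 : (n : ℝ) ≠ 0 := by positivity
    have hμ01 := PACBayes.mean_mem_Icc Pr f hf01 (X 0)
    have he01 := PACBayes.empMean_mem_Icc f hf01 s
    rw [← integral_sub
      (Integrable.of_mem_Icc 0 1 hμ.aemeasurable (ae_of_all _ hμ01))
      (Integrable.of_mem_Icc 0 1 he.aemeasurable (ae_of_all _ he01))]
    refine PACBayes.abs_integral_le_of_lintegral_exp_le (P s) P₀ hkl _ (hμ.sub he)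
      (fun θ => ?_) n hn (1 / δ) (by positivity) ?_
    · rw [Pi.sub_apply, abs_le]
      constructor <;> linarith [(hμ01 θ).1, (hμ01 θ).2, (he01 θ).1, (he01 θ).2]
    · refine le_trans (le_of_eq ?_) hlt
      change _ = ∫⁻ l, ∏ i ∈ Finset.range n, h l (X i ω) ∂(P₀.prod (gaussianReal 0 1))
      have hprodω : Measurable fun l : Θ × ℝ => ∏ i ∈ Finset.range n, h l (X i ω) :=
        Finset.measurable_fun_prod _ fun i _ =>
          hh.comp (measurable_id.prodMk (measurable_const (a := X i ω)))
      rw [lintegral_prod (fun l => ∏ i ∈ Finset.range n, h l (X i ω)) hprodω.aemeasurable]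
      refine lintegral_congr fun θ => ?_
      -- The bets use `f - μ_θ`, the opposite sign to the deviation, hence the minus; `n/8` collects
      -- the `n` terms `t²/8`.
      have hquad := PACBayes.lintegral_exp_quadratic_gaussianReal
        (-(n * (PACBayes.mean Pr f (X 0) θ - PACBayes.empMean f s θ))) (n / 8) (by positivity)
      rw [neg_sq] at hquad
      refine hquad.symm.trans (lintegral_congr fun t => ?_)
      simp only [hdef]
      rw [← ENNReal.ofReal_prod_of_nonneg fun i _ => (Real.exp_pos _).le, ← Real.exp_sum,
        Finset.sum_sub_distrib, ← Finset.mul_sum, Finset.sum_sub_distrib,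
        ← Fin.sum_univ_eq_sum_range fun i => f θ (X i ω), PACBayes.empMean]
      simp only [Finset.sum_const, Finset.card_range, nsmul_eq_mul, hs]
      congr 2
      field_simp
      ring
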